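/- For a scheme $S$, let $S_{\mathrm{p\acute et}}$ be its pro-étale site: the objects are the weakly étale $S$-schemes (flat with flat diagonal), and the coverings are the fpqc coverings, i.e. the families $\{U_i\to X\}$ such that every affine open of $X$ is the union of the images of finitely many affine opens of the $U_i$. A hypercovering of $S$ is a simplicial object $U_\bullet$ of $S_{\mathrm{p\acute et}}$ such that $U_0\to S$ and the natural morphisms $U_{n+1}\to\mathrm{cosk}_n(U_\bullet)_{n+1}$, $n\ge 0$, are coverings. Let $\mathrm{Ho}(\mathrm{Hy}(S))$ be the category of hypercoverings of $S$ and morphisms of simplicial objects, with (simplicially) homotopic morphisms identified, and let $\mathrm{Ho}(\mathrm{sTop})$ be the category of simplicial topological spaces with homotopic morphisms identified. For a space $X$ let $\pi(X)$ be the set of connected components with the quotient topology; for a scheme apply $\pi$ to the underlying space. When $\mathrm{Ho}(\mathrm{Hy}(S))$ is cofiltered, the functor $$\Pi_{\mathrm{p\acute e}}(S)\colon \mathrm{Ho}(\mathrm{Hy}(S))\to\mathrm{Ho}(\mathrm{sTop}),\qquad U_\bullet\mapsto\pi(U_\bullet),$$ is a pro-object in $\mathrm{Ho}(\mathrm{sTop})$,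 the pro-étale homotopy type of $S$; morphisms of pro-objects are $\mathrm{Hom}(X,Y)=\lim_j\operatorname{colim}_i\mathrm{Hom}(X_i,Y_j)$. Write $\mathrm c(-)_\bullet$ for constant simplicial objects. An affine scheme $W$ is w-contractible if every surjective weakly étale morphism $A\to W$ with $A$ affine has a section. Corollary. Let $W$ be a w-contractible scheme. 1. The inclusion of the hypercovering $\mathrm c(W)_\bullet$ into $\mathrm{Ho}(\mathrm{Hy}(W))$, as a functor from the category with one object and one morphism, is initial. 2. The category $\mathrm{Ho}(\mathrm{Hy}(W))$ is cofiltered, and the natural morphism of pro-objects $\Pi_{\mathrm{p\acute e}}(W)\to \mathrm c(\pi(W))_\bullet$ in $\mathrm{Ho}(\mathrm{sTop})$, given by projection to the member $\pi(\mathrm c(W)_\bullet)=\mathrm c(\pi(W))_\bullet$, is an isomorphism. Moreover, $\operatorname{Spec} k$ is w-contractible for every algebraically closed field $k$; in particular, 1 and 2 hold for $W=\operatorname{Spec} k$. -/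

import Mathlib

open CategoryTheory Limits AlgebraicGeometry Opposite
open scoped Simplicial

universe w w' v u

namespace ProEtaleHomotopy

noncomputable section

/-! ### Pro-objects -/

/-- A pro-object in `C`: a functor to `C` from a variable cofiltered category. -/
structure ProObj (C : Type u) [Category.{v} C] where
  Index : Type w
  [cat : Category.{w'} Index]
  [cofiltered : IsCofiltered Index]
  diagram : Index ⥤ C

attribute [instance] ProObj.cat ProObj.cofiltered

namespace ProObj

variable {C : Type u} [Category.{v} C]

/-- The relation generating the identifications in `colim_i Hom(X_i, Z)`. -/
def GermRel (X : ProObj.{w, w'} C) (Z : C) (a b : Σ i : X.Index, (X.diagram.obj i ⟶ Z)) : Prop :=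
  ∃ φ : b.1 ⟶ a.1, b.2 = X.diagram.map φ ≫ a.2

/-- The set `colim_i Hom(X_i, Z)`. -/
def Germ (X : ProObj.{w, w'} C) (Z : C) : Type (max w v) := Quot (X.GermRel Z)

/-- The class in `colim_i Hom(X_i, Z)` of a morphism `X_i ⟶ Z`. -/
def Germ.mk (X : ProObj.{w, w'} C) {Z : C} (i : X.Index) (f : X.diagram.obj i ⟶ Z) : X.Germ Z :=
  Quot.mk _ ⟨i, f⟩

theorem Germ.mk_map (X : ProObj.{w, w'} C) {Z : C} {i i' : X.Index} (φ : i' ⟶ i)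
    (f : X.diagram.obj i ⟶ Z) : Germ.mk X i' (X.diagram.map φ ≫ f) = Germ.mk X i f :=
  (Quot.sound ⟨φ, rfl⟩).symm

theorem Germ.ind {X : ProObj.{w, w'} C} {Z : C} {P : X.Germ Z → Prop}
    (h : ∀ i f, P (Germ.mk X i f)) (a : X.Germ Z) : P a :=
  Quot.ind (fun x => h x.1 x.2) a

/-- The map `colim_i Hom(X_i, Z) → colim_i Hom(X_i, Z')` induced by `g : Z ⟶ Z'`. -/
def Germ.postcomp {X : ProObj.{w, w'} C} {Z Z' : C} (a : X.Germ Z) (g : Z ⟶ Z') : X.Germ Z' :=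
  Quot.lift (fun x => Germ.mk X x.1 (x.2 ≫ g))
    (by
      rintro ⟨i, f⟩ ⟨i', f'⟩ ⟨φ, h⟩
      dsimp only at h φ ⊢
      rw [h, Category.assoc, Germ.mk_map]) a

@[simp]
theorem Germ.postcomp_mk {X : ProObj.{w, w'} C} {Z Z' : C} (i : X.Index)
    (f : X.diagram.obj i ⟶ Z) (g : Z ⟶ Z') :
    (Germ.mk X i f).postcomp g = Germ.mk X i (f ≫ g) := rfl

@[simp]
theorem Germ.postcomp_comp {X : ProObj.{w, w'} C} {Z Z' Z'' : C} (a : X.Germ Z)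
    (g : Z ⟶ Z') (h : Z' ⟶ Z'') : a.postcomp (g ≫ h) = (a.postcomp g).postcomp h := by
  induction a using Germ.ind with
  | h i f => simp

@[simp]
theorem Germ.postcomp_id {X : ProObj.{w, w'} C} {Z : C} (a : X.Germ Z) :
    a.postcomp (𝟙 Z) = a := by
  induction a using Germ.ind with
  | h i f => simp

/-- Morphisms of pro-objects: the elements of `lim_j colim_i Hom(X_i, Y_j)`. -/
@[ext]
structure Hom (X Y : ProObj.{w, w'} C) where
  val (j : Y.Index) : X.Germ (Y.diagram.obj j)
  compat {j j' : Y.Index} (ψ : j ⟶ j') : (val j).postcomp (Y.diagram.map ψ) = val j'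

/-- The map `colim_j Hom(Y_j, Z) → colim_i Hom(X_i, Z)` induced by a morphism `X ⟶ Y`. -/
def Hom.pull {X Y : ProObj.{w, w'} C} (f : Hom X Y) {Z : C} (a : Y.Germ Z) : X.Germ Z :=
  Quot.lift (fun x => (f.val x.1).postcomp x.2)
    (by
      rintro ⟨i, g⟩ ⟨i', g'⟩ ⟨φ, h⟩
      dsimp only at h φ ⊢
      rw [h, Germ.postcomp_comp, f.compat]) a

@[simp]
theorem Hom.pull_mk {X Y : ProObj.{w, w'} C} (f : Hom X Y) {Z : C} (j : Y.Index)
    (g : Y.diagram.obj j ⟶ Z) : f.pull (Germ.mk Y j g) = (f.val j).postcomp g := rfl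

theorem Hom.pull_postcomp {X Y : ProObj.{w, w'} C} (f : Hom X Y) {Z Z' : C} (a : Y.Germ Z)
    (g : Z ⟶ Z') : f.pull (a.postcomp g) = (f.pull a).postcomp g := by
  induction a using Germ.ind with
  | h i f => simp

instance : Category (ProObj.{w, w'} C) where
  Hom := Hom
  id X :=
    { val := fun j => Germ.mk X j (𝟙 _)
      compat := fun ψ => by
        rw [Germ.postcomp_mk, Category.id_comp]
        simpa using Germ.mk_map X ψ (𝟙 _) }
  comp f g :=
    { val := fun k => f.pull (g.val k)
      compat := fun ψ => by rw [← Hom.pull_postcomp, g.compat] }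
  id_comp {X Y} f := by
    refine Hom.ext (funext fun k => ?_)
    dsimp only
    induction f.val k using Germ.ind with
    | h i f => simp
  comp_id f := by
    refine Hom.ext (funext fun k => ?_)
    simp
  assoc f g h := by
    refine Hom.ext (funext fun k => ?_)
    dsimp only
    induction h.val k using Germ.ind with
    | h i f => simp [Hom.pull_postcomp]

/-- The category with one object and one morphism, in arbitrary universes. -/
structure Pt : Type w where

instance : Category.{w'} Pt.{w} where
  Hom _ _ := PUnit
  id _ := ⟨⟩
  comp _ _ := ⟨⟩

instance : IsCofiltered Pt.{w} where
  nonempty := ⟨⟨⟩⟩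
  cone_objs _ _ := ⟨⟨⟩, ⟨⟩, ⟨⟩, trivial⟩
  cone_maps _ _ _ _ := ⟨⟨⟩, ⟨⟩, rfl⟩

/-- An object of `C`, seen as a pro-object indexed by the category with one morphism. -/
abbrev const (Z : C) : ProObj.{w, w'} C where
  Index := Pt.{w}
  diagram := (Functor.const _).obj Z

/-- The morphism of pro-objects `X ⟶ Z` represented by a morphism `X_i ⟶ Z`. -/
def toConst (X : ProObj.{w, w'} C) {Z : C} (i : X.Index) (f : X.diagram.obj i ⟶ Z) :
    X ⟶ const.{w, w'} Z :=
  { val := fun _ => Germ.mk X i f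
    compat := fun _ => congrArg (Germ.mk X i) (Category.comp_id f) : Hom X (const Z) }

end ProObj

/-! ### Homotopy categories of simplicial objects -/

/-- The relation on morphisms of simplicial objects given by (simplicial) homotopies. -/
def homotopyRel (C : Type u) [Category.{v} C] : HomRel (SimplicialObject C) :=
  fun _ _ f g => Nonempty (SimplicialObject.Homotopy f g)

/-- The homotopy category `Ho(sC)`: simplicial objects, with homotopic morphisms identified. -/
abbrev HoSimplicial (C : Type u) [Category.{v} C] := CategoryTheory.Quotient (homotopyRel C)

/-! ### Hypercoverings in the pro-étale site -/

section Coskeleton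

instance (m : SimplexCategory) (k : SimplexCategory) : Finite (k ⟶ m) :=
  Finite.of_injective (fun f => (f.toOrderHom : Fin (k.len + 1) → Fin (m.len + 1)))
    (fun _ _ h => SimplexCategory.Hom.ext _ _ (OrderHom.ext _ _ h))

instance (n : ℕ) (d : SimplexCategoryᵒᵖ) :
    Finite (StructuredArrow d (SimplexCategory.Truncated.inclusion n).op) := by
  let F : (Σ k : Fin (n + 1), (SimplexCategory.mk k ⟶ d.unop)) →
      StructuredArrow d (SimplexCategory.Truncated.inclusion n).op := fun x =>
    StructuredArrow.mk (S := d) (T := (SimplexCategory.Truncated.inclusion n).op)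
      (Y := op (⟨SimplexCategory.mk x.1, Nat.lt_succ_iff.mp x.1.2⟩ : SimplexCategory.Truncated n))
      (Quiver.Hom.op x.2)
  refine Finite.of_surjective F ?_
  rintro ⟨⟨⟨⟩⟩, ⟨⟨Y, hY⟩⟩, f⟩
  exact ⟨⟨⟨Y.len, Nat.lt_succ_iff.mpr hY⟩, f.unop⟩, rfl⟩

instance (n : ℕ) (d : SimplexCategoryᵒᵖ)
    (x y : StructuredArrow d (SimplexCategory.Truncated.inclusion n).op) : Finite (x ⟶ y) :=
  Finite.of_injective (fun f => f.right.unop.hom) (fun _ _ h =>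
    StructuredArrow.hom_ext _ _ (Quiver.Hom.unop_inj (ObjectProperty.hom_ext _ h)))

instance (n : ℕ) (d : SimplexCategoryᵒᵖ) :
    FinCategory (StructuredArrow d (SimplexCategory.Truncated.inclusion n).op) where
  fintypeObj := Fintype.ofFinite _
  fintypeHom _ _ := Fintype.ofFinite _

/-- In a category with finite limits, all coskeleta exist. -/
instance {C : Type u} [Category.{v} C] [HasFiniteLimits C] (n : ℕ)
    (F : (SimplexCategory.Truncated n)ᵒᵖ ⥤ C) :
    (SimplexCategory.Truncated.inclusion n).op.HasPointwiseRightKanExtension F :=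
  fun d => show HasLimit _ from
    have : HasLimitsOfShape (StructuredArrow d (SimplexCategory.Truncated.inclusion n).op) C :=
      hasLimitsOfShape_of_hasFiniteLimits ..
    inferInstance

end Coskeleton

variable (S : Scheme.{u})

/-- A morphism `U ⟶ X` in the pro-étale site of `S` is a covering if the family consisting of this
morphism alone is a covering family. -/
def IsCovering {S : Scheme.{u}} {U X : S.ProEt} (f : U ⟶ X) : Prop :=
  Presieve.singleton f ∈ Scheme.ProEt.precoverage S X

/-- The scheme `S` as an object of its pro-étale site. -/
def self : S.ProEt := Scheme.ProEt.mk (𝟙 S)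

/-- The scheme `S` is the terminal object of its pro-étale site. -/
def selfIsTerminal : IsTerminal (self S) :=
  IsTerminal.ofUniqueHom
    (fun X => (Scheme.ProEt.forgetFullyFaithful S).preimage
      (Over.homMk X.hom (Category.comp_id _) : _ ⟶ Over.mk (𝟙 S)))
    (fun _ _ => (Scheme.ProEt.forget S).map_injective (Over.mkIdTerminal.hom_ext _ _))

/-- A simplicial object `U` of the pro-étale site of `S` is a hypercovering if `U₀ ⟶ S` and the
natural morphisms `Uₙ₊₁ ⟶ coskₙ(U)ₙ₊₁` are coverings. -/
structure IsHypercovering (U : SimplicialObject S.ProEt) : Prop where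
  zero : IsCovering ((selfIsTerminal S).from (U _⦋0⦌))
  succ (n : ℕ) : IsCovering (((SimplicialObject.coskAdj n).unit.app U).app (op ⦋n + 1⦌))

/-- The category `Hy(S)` of hypercoverings of `S`. -/
abbrev Hy := ObjectProperty.FullSubcategory (IsHypercovering S)

/-- The relation on morphisms of hypercoverings given by (simplicial) homotopies. -/
def hyHomotopyRel : HomRel (Hy S) := fun _ _ f g => homotopyRel S.ProEt f.hom g.hom

/-- The homotopy category `Ho(Hy(S))` of hypercoverings of `S`. -/
abbrev HoHy := CategoryTheory.Quotient (hyHomotopyRel S)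

/-- The constant simplicial object `c(S)` of the pro-étale site of `S`. -/
def constSelf : SimplicialObject S.ProEt := (SimplicialObject.const _).obj (self S)

theorem isCovering_of_isIso {S : Scheme.{u}} {U X : S.ProEt} (f : U ⟶ X) [IsIso f] :
    IsCovering f := by
  unfold IsCovering Scheme.ProEt.precoverage
  rw [Precoverage.mem_comap_iff, Presieve.map_singleton]
  exact Precoverage.HasIsos.mem_coverings_of_isIso _

theorem isHypercovering_constSelf : IsHypercovering S (constSelf S) := by
  have term {J : Type} [Category.{0} J] :
      IsTerminal ((Functor.const J).obj (self S)) :=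
    IsTerminal.ofUniqueHom
      (fun X => { app := fun j => (selfIsTerminal S).from (X.obj j)
                  naturality := fun _ _ _ => (selfIsTerminal S).hom_ext _ _ })
      (fun X m => by
        ext j
        exact (selfIsTerminal S).hom_ext _ _)
  constructor
  · have : IsIso ((selfIsTerminal S).from ((constSelf S) _⦋0⦌)) :=
      isIso_of_isTerminal (selfIsTerminal S) (selfIsTerminal S) _
    exact isCovering_of_isIso _
  · intro n
    have h : IsTerminal ((SimplicialObject.truncation n ⋙
        SimplicialObject.Truncated.cosk n).obj (constSelf S)) := by
      have h' : IsTerminal ((SimplicialObject.truncation n).obj (constSelf S)) := term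
      have := (SimplicialObject.coskAdj (C := S.ProEt) n).rightAdjoint_preservesLimits.{0, 0}
      exact IsTerminal.isTerminalObj (SimplicialObject.Truncated.cosk n) _ h'
    have : IsIso ((SimplicialObject.coskAdj n).unit.app (constSelf S)) :=
      isIso_of_isTerminal term h _
    exact isCovering_of_isIso _

/-- The constant simplicial object `c(S)`, as a hypercovering of `S` up to homotopy. -/
def constHy : HoHy S := (CategoryTheory.Quotient.functor _).obj ⟨constSelf S, isHypercovering_constSelf S⟩

/-! ### The pro-étale homotopy type -/

/-- The space of components `π : Top ⥤ Top`, with its quotient topology. -/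
def spaceOfComponents : TopCat.{u} ⥤ TopCat.{u} where
  obj X := TopCat.of (ConnectedComponents X)
  map f := TopCat.ofHom ⟨f.hom.continuous.connectedComponentsMap,
    f.hom.continuous.connectedComponentsMap_continuous⟩
  map_id X := by
    ext x
    obtain ⟨x, rfl⟩ := ConnectedComponents.surjective_coe x
    rfl
  map_comp f g := by
    ext x
    obtain ⟨x, rfl⟩ := ConnectedComponents.surjective_coe x
    rfl

/-- The functor sending an object `X ⟶ S` of the pro-étale site of `S` to the space of components
of (the topological space underlying) `X`. -/
def components : S.ProEt ⥤ TopCat.{u} :=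
  Scheme.ProEt.forget S ⋙ Over.forget S ⋙ Scheme.forgetToTop ⋙ spaceOfComponents

/-- The functor `Ho(Hy(S)) ⥤ Ho(sTop)` sending `U` to `π(U)`. -/
def componentsHoHy : HoHy S ⥤ HoSimplicial TopCat.{u} :=
  CategoryTheory.Quotient.lift _
    (ObjectProperty.ι _ ⋙ (SimplicialObject.whiskering _ _).obj (components S) ⋙
      CategoryTheory.Quotient.functor _)
    (fun _ _ _ _ ⟨H⟩ => CategoryTheory.Quotient.sound _ ⟨H.whiskerRight (components S)⟩)

/-- The pro-étale homotopy type of `S`: the functor `U ↦ π(U)` from `Ho(Hy(S))` to `Ho(sTop)`,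
which is a pro-object as soon as `Ho(Hy(S))` is cofiltered. -/
abbrev proEtaleHomotopyType [IsCofiltered (HoHy S)] :
    ProObj.{u + 1, u} (HoSimplicial TopCat.{u}) where
  Index := HoHy S
  diagram := componentsHoHy S

/-- The constant simplicial space `c(π(S))` in `Ho(sTop)`. -/
def constComponents : HoSimplicial TopCat.{u} :=
  (CategoryTheory.Quotient.functor _).obj
    ((SimplicialObject.const _).obj (spaceOfComponents.obj (Scheme.forgetToTop.obj S)))

/-- The tautological identification of `π(c(S))` with `c(π(S))`. -/
def componentsConstHy : (componentsHoHy S).obj (constHy S) ≅ constComponents S :=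
  (CategoryTheory.Quotient.functor _).mapIso
    (NatIso.ofComponents (fun _ => Iso.refl _) (fun _ => by
        exact (Category.comp_id _).trans (((components S).map_id _).trans (Category.id_comp _).symm)) :
      ((SimplicialObject.whiskering _ _).obj (components S)).obj (constSelf S) ≅
        (SimplicialObject.const _).obj (spaceOfComponents.obj (Scheme.forgetToTop.obj S)))

/-- The natural morphism from the pro-étale homotopy type of `S` to `c(π(S))`: the projection to
the member `π(c(S))` of the pro-object. -/
def toConstComponents [IsCofiltered (HoHy S)] :
    proEtaleHomotopyType S ⟶ ProObj.const (constComponents S) :=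
  (proEtaleHomotopyType S).toConst (constHy S) (componentsConstHy S).hom

/-! ### w-contractible schemes -/

/-- An affine scheme `W` is w-contractible if any surjective weakly étale morphism `A ⟶ W` from an
affine scheme `A` admits a section. -/
structure IsWContractible (W : Scheme.{u}) : Prop where
  isAffine : IsAffine W
  exists_section (A : Scheme.{u}) (f : A ⟶ W) : IsAffine A → WeaklyEtale f → Surjective f →
    ∃ s : W ⟶ A, s ≫ f = 𝟙 W

end

end ProEtaleHomotopy

/-!
For a w-contractible scheme `W` the constant hypercovering `c(W)` is an initial object of
`Ho(Hy(W))`. Initiality of the inclusion of `c(W)`, cofilteredness, and the fact that the projection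
to the member at `c(W)` is an isomorphism of pro-objects then hold for any category with an initial
object.

The reason for initiality is that `W` is projective for pro-étale coverings
(`IsWContractible.exists_lift_of_isCovering`): a covering of `W` is refined by a finite disjoint
union of affine opens, which has a section by definition. A morphism `c(W) ⟶ U` is a vertex
`W ⟶ U₀`, which exists since `U₀ ⟶ W` is a covering (`constHomOfVertex`). Two such vertices form an
edge `W ⟶ cosk₀(U)₁` (`exists_to_cosk_zero`), which lifts along the covering `U₁ ⟶ cosk₀(U)₁` to an
edge of `U`, and the degeneracies of that edge are a homotopy between the two morphisms
(`homotopyOfEdge`).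

For `k` algebraically closed, an affine weakly étale surjection to `Spec k` is given by a nonzero
`k`-algebra `B` with `B ⊗ B → B` flat. Flatness provides, for each `b : B`, an element `u` of
`B ⊗ B` which is annihilated by `b ⊗ 1 - 1 ⊗ b` and maps to `1` in `B`. If the image `x` of `b` in a
residue field `K` were transcendental, `x ⊗ 1 - 1 ⊗ x` would be a nonzerodivisor of `K ⊗ K`
(`eq_zero_of_transcendental_of_mul_eq_zero`), which contradicts the existence of `u`. So the residue
fields at maximal ideals are algebraic over `k`, and any of them gives a section.
-/

namespace ProEtaleHomotopy

/-! ### Algebras with flat multiplication over an algebraically closed field -/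

section Algebra

open TensorProduct Polynomial

/-- If the multiplication map `B ⊗ B → B` is flat, then `b ⊗ 1 - 1 ⊗ b`, which it kills, is
annihilated by some `u` mapping to `1`: apply the equational criterion for flatness to the
relation `(b ⊗ 1 - 1 ⊗ b) • 1 = 0` in the `B ⊗ B`-module `B`. -/
theorem exists_mul_eq_zero_and_lmul'_eq_one {k B : Type*} [CommRing k] [CommRing B] [Algebra k B]
    (h : (Algebra.TensorProduct.lmul' k (S := B)).Flat) (b : B) :
    ∃ u : B ⊗[k] B, (b ⊗ₜ 1 - 1 ⊗ₜ b) * u = 0 ∧ Algebra.TensorProduct.lmul' k u = 1 := by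
  algebraize [(Algebra.TensorProduct.lmul' k (S := B)).toRingHom]
  have hsmul (r : B ⊗[k] B) (c : B) : r • c = Algebra.TensorProduct.lmul' k r * c := rfl
  obtain ⟨l, a, y, hy, ha⟩ := Module.Flat.isTrivialRelation_of_sum_smul_eq_zero (ι := Unit)
    (f := fun _ => (b ⊗ₜ 1 - 1 ⊗ₜ b : B ⊗[k] B)) (x := fun _ => (1 : B)) (by simp [hsmul])
  refine ⟨∑ j, a () j * (1 ⊗ₜ y j), ?_, ?_⟩
  · rw [Finset.mul_sum]
    refine Finset.sum_eq_zero fun j _ => ?_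
    have : (b ⊗ₜ 1 - 1 ⊗ₜ b) * a () j = 0 := by simpa using ha j
    rw [← mul_assoc, this, zero_mul]
  · simpa [hsmul] using (hy ()).symm

/-- For `x` transcendental over `k`, the element `x ⊗ 1 - 1 ⊗ x` of `K ⊗ K` is a nonzerodivisor.
Let `k[X]` act on `K` through `X ↦ x`. Then `K` is torsion-free, hence flat, over `k[X]`, and
`K ⊗[k] K` is the base change to `K` of `k[X] ⊗[k] K ≃ K[X]`, a domain in which the element
corresponds to `X - C x ≠ 0`. -/
theorem eq_zero_of_transcendental_of_mul_eq_zero {k K : Type*} [Field k] [Field K]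
    [Algebra k K] {x : K} (hx : Transcendental k x) {u : K ⊗[k] K} (hu : (x ⊗ₜ 1 - 1 ⊗ₜ x) * u = 0) :
    u = 0 := by
  algebraize [(aeval (R := k) x).toRingHom]
  have hsmul (p : k[X]) (c : K) : p • c = aeval x p * c := rfl
  have : IsScalarTower k k[X] K := .of_algebraMap_eq fun r => by
    change _ = aeval x (C r)
    simp
  have : Module.IsTorsionFree k[X] K :=
    Module.isTorsionFree_iff_algebraMap_injective.2 (transcendental_iff_injective.1 hx)
  have : Module.Flat k[X] K := inferInstance
  let p : K[X] ≃ₐ[k] k[X] ⊗[k] K :=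
    (polyEquivTensor k K).trans (Algebra.TensorProduct.comm k K k[X])
  have : IsDomain (k[X] ⊗[k] K) := p.symm.toMulEquiv.isDomain _
  let r : k[X] ⊗[k] K := X ⊗ₜ 1 - 1 ⊗ₜ x
  have hr : r ≠ 0 := by
    have hp : p.symm r = X - C x := by simp [r, p, smul_eq_C_mul]
    refine fun h => X_sub_C_ne_zero x ?_
    rw [← hp, h, map_zero]
  have hinj : Function.Injective (LinearMap.mulLeft k[X] r) := mul_right_injective₀ hr
  let e := AlgebraTensorModule.cancelBaseChange k k[X] k[X] K K
  have key : (LinearMap.mulLeft k[X] (x ⊗ₜ 1 - 1 ⊗ₜ x : K ⊗[k] K)) ∘ₗ e.toLinearMap =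
      e.toLinearMap ∘ₗ (LinearMap.mulLeft k[X] r).lTensor K := by
    ext a b
    simp [e, r, sub_mul, tmul_sub, hsmul]
  obtain ⟨v, rfl⟩ := e.surjective u
  have hv : e ((LinearMap.mulLeft k[X] r).lTensor K v) = 0 :=
    (LinearMap.congr_fun key v).symm.trans hu
  rw [LinearEquiv.map_eq_zero_iff] at hv
  rw [(map_eq_zero_iff _ (Module.Flat.lTensor_preserves_injective_linearMap (M := K) _ hinj)).1 hv,
    map_zero]

/-- A nonzero algebra with flat multiplication map over an algebraically closed field `k` has a
`k`-point: each of its residue fields at maximal ideals is algebraic over `k`. -/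
theorem nonempty_algHom_of_flat_lmul' {k B : Type*} [Field k] [IsAlgClosed k] [CommRing B]
    [Nontrivial B] [Algebra k B] (h : (Algebra.TensorProduct.lmul' k (S := B)).Flat) :
    Nonempty (B →ₐ[k] k) := by
  obtain ⟨m, hm⟩ := Ideal.exists_maximal B
  let := Ideal.Quotient.field m
  let π := Ideal.Quotient.mkₐ k m
  have hcomp : (Algebra.TensorProduct.lmul' k (S := B ⧸ m)).comp (Algebra.TensorProduct.map π π) =
      π.comp (Algebra.TensorProduct.lmul' k (S := B)) := by
    ext <;> simp
  have halg : Algebra.IsAlgebraic k (B ⧸ m) := by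
    refine ⟨fun x => ?_⟩
    obtain ⟨b, rfl⟩ := Ideal.Quotient.mk_surjective x
    by_contra hb
    obtain ⟨u, hu, hu'⟩ := exists_mul_eq_zero_and_lmul'_eq_one h b
    -- In the residue field, `u` is annihilated by `x ⊗ 1 - 1 ⊗ x` but still maps to `1`.
    have h0 := eq_zero_of_transcendental_of_mul_eq_zero hb (u := Algebra.TensorProduct.map π π u)
      (by simpa [π] using congrArg (Algebra.TensorProduct.map π π) hu)
    have h1 := DFunLike.congr_fun hcomp u
    simp [h0, hu'] at h1
  exact ⟨(IsAlgClosed.lift : B ⧸ m →ₐ[k] k).comp π⟩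

end Algebra

/-! ### Homotopies between morphisms from a constant simplicial object -/

/-- The surjection `[n + 1] → [1]` with fibres `{0, …, i}` and `{i + 1, …, n + 1}`. Pulling back an edge along
these maps yields the components of a homotopy between the constant simplices at its ends. -/
def cut {n : ℕ} (i : Fin (n + 1)) : (⦋n + 1⦌ : SimplexCategory) ⟶ ⦋1⦌ :=
  SimplexCategory.mkHom
    { toFun := fun k => if k ≤ i.castSucc then 0 else 1
      monotone' := fun a b hab => by
        dsimp only
        split_ifs with h₁ h₂
        · exact le_rfl
        · exact Fin.zero_le _
        · exact absurd (hab.trans ‹_›) h₁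
        · exact le_rfl }

theorem comp_cut_apply {n : ℕ} {m : SimplexCategory} (f : m ⟶ ⦋n + 1⦌) (i : Fin (n + 1))
    (k : Fin (m.len + 1)) :
    (f ≫ cut i).toOrderHom k = if (f.toOrderHom k).val ≤ i.val then (0 : Fin 2) else (1 : Fin 2) :=
  rfl

/-- A composite with `cut i` is determined by the preimage of `{0, …, i}`, which turns the simplicial
identities for `cut` into linear arithmetic. -/
theorem comp_cut_congr {n n' : ℕ} {m : SimplexCategory} {f : m ⟶ ⦋n + 1⦌} {f' : m ⟶ ⦋n' + 1⦌}
    {i : Fin (n + 1)} {i' : Fin (n' + 1)}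
    (h : ∀ k, (f.toOrderHom k).val ≤ i.val ↔ (f'.toOrderHom k).val ≤ i'.val) :
    f ≫ cut i = f' ≫ cut i' := by
  ext k : 3
  simp only [comp_cut_apply, h]

theorem comp_cut_eq_cut {n n' : ℕ} {f : (⦋n' + 1⦌ : SimplexCategory) ⟶ ⦋n + 1⦌}
    {i : Fin (n + 1)} {i' : Fin (n' + 1)}
    (h : ∀ k : Fin (n' + 2), (f.toOrderHom k).val ≤ i.val ↔ k.val ≤ i'.val) :
    f ≫ cut i = cut i' := by
  rw [← Category.id_comp (cut i')]
  exact comp_cut_congr h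

theorem δ_val {n : ℕ} (i : Fin (n + 2)) (k : Fin (n + 1)) :
    ((SimplexCategory.δ i).toOrderHom k).val = if k.val < i.val then k.val else k.val + 1 := by
  change (Fin.succAbove i k).val = _
  grind [Fin.succAbove]

theorem σ_val {n : ℕ} (i : Fin (n + 1)) (k : Fin (n + 2)) :
    ((SimplexCategory.σ i).toOrderHom k).val = if k.val ≤ i.val then k.val else k.val - 1 := by
  change (Fin.predAbove i k).val = _
  unfold Fin.predAbove
  split_ifs <;> simp <;> grind

theorem δ_zero_cut (n : ℕ) : SimplexCategory.δ 0 ≫ cut (0 : Fin (n + 1)) =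
    SimplexCategory.const ⦋n⦌ ⦋0⦌ 0 ≫ SimplexCategory.δ 0 := by
  ext k : 3
  rw [comp_cut_apply, δ_val]
  rfl

theorem δ_last_cut (n : ℕ) : SimplexCategory.δ (Fin.last (n + 1)) ≫ cut (Fin.last n) =
    SimplexCategory.const ⦋n⦌ ⦋0⦌ 0 ≫ SimplexCategory.δ 1 := by
  ext k : 3
  rw [comp_cut_apply, δ_val]
  have : k.val < n + 1 := k.isLt
  rw [if_pos (by grind)]
  rfl

theorem δ_castSucc_cut_succ {n : ℕ} (i : Fin (n + 2)) (j : Fin (n + 1)) (hij : i ≤ j.castSucc) :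
    SimplexCategory.δ i.castSucc ≫ cut j.succ = cut j :=
  comp_cut_eq_cut fun k => by rw [δ_val]; grind

theorem δ_succ_castSucc_cut_succ {n : ℕ} (j : Fin (n + 1)) :
    SimplexCategory.δ j.castSucc.succ ≫ cut j.succ =
      SimplexCategory.δ j.castSucc.succ ≫ cut j.castSucc :=
  comp_cut_congr fun k => by rw [δ_val]; grind

theorem δ_succ_cut_castSucc {n : ℕ} (i : Fin (n + 2)) (j : Fin (n + 1)) (hij : j.castSucc < i) :
    SimplexCategory.δ i.succ ≫ cut j.castSucc = cut j :=
  comp_cut_eq_cut fun k => by rw [δ_val]; grind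

theorem σ_castSucc_cut {n : ℕ} (i j : Fin (n + 1)) (hij : i ≤ j) :
    SimplexCategory.σ i.castSucc ≫ cut j = cut j.succ :=
  comp_cut_eq_cut fun k => by rw [σ_val]; grind

theorem σ_succ_cut {n : ℕ} (i j : Fin (n + 1)) (hij : j ≤ i) :
    SimplexCategory.σ i.succ ≫ cut j = cut j.castSucc :=
  comp_cut_eq_cut fun k => by rw [σ_val]; grind

section Simplicial

variable {C : Type u} [Category.{v} C]

/-- The morphism from a constant simplicial object `c(T)` to `U` given by a vertex `T ⟶ U₀` and its
degeneracies. -/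
def constHomOfVertex {T : C} {U : SimplicialObject C} (x : T ⟶ U _⦋0⦌) :
    (SimplicialObject.const C).obj T ⟶ U where
  app m := x ≫ U.map (SimplexCategory.const m.unop ⦋0⦌ 0).op
  naturality m m' f := by
    have : (SimplexCategory.const m'.unop ⦋0⦌ 0).op =
        (SimplexCategory.const m.unop ⦋0⦌ 0).op ≫ f := rfl
    rw [this, Functor.map_comp]
    simp

/-- Two morphisms `ξ, η` from a constant simplicial object `c(T)` to `U` are homotopic if some
edge `z : T ⟶ U₁` joins their vertices `T ⟶ U₀`. The homotopy consists of the degeneracies of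
`z`. -/
def homotopyOfEdge {T : C} {U : SimplicialObject C} (ξ η : (SimplicialObject.const C).obj T ⟶ U)
    (z : T ⟶ U _⦋1⦌) (h₁ : z ≫ U.δ 1 = ξ.app (op ⦋0⦌)) (h₀ : z ≫ U.δ 0 = η.app (op ⦋0⦌)) :
    SimplicialObject.Homotopy ξ η where
  h i := z ≫ U.map (cut i).op
  h_zero_comp_δ_zero n := by
    have := η.naturality (SimplexCategory.const ⦋n⦌ ⦋0⦌ 0).op
    simp [← h₀] at this
    simp [SimplicialObject.δ, ← Functor.map_comp, ← op_comp, δ_zero_cut] at this ⊢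
    exact this.symm
  h_last_comp_δ_last n := by
    have := ξ.naturality (SimplexCategory.const ⦋n⦌ ⦋0⦌ 0).op
    simp [← h₁] at this
    simp [SimplicialObject.δ, ← Functor.map_comp, ← op_comp, δ_last_cut] at this ⊢
    exact this.symm
  h_succ_comp_δ_castSucc_of_lt i j hij := by
    simp [SimplicialObject.δ, ← Functor.map_comp, ← op_comp, δ_castSucc_cut_succ _ _ hij]
  h_succ_comp_δ_castSucc_succ j := by
    simp only [SimplicialObject.δ, ← Functor.map_comp, ← op_comp, Category.assoc,
      δ_succ_castSucc_cut_succ]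
  h_castSucc_comp_δ_succ_of_lt i j hij := by
    simp [SimplicialObject.δ, ← Functor.map_comp, ← op_comp, δ_succ_cut_castSucc _ _ hij]
  h_comp_σ_castSucc_of_le i j hij := by
    simp [SimplicialObject.σ, ← Functor.map_comp, ← op_comp, σ_castSucc_cut _ _ hij]
  h_comp_σ_succ_of_lt i j hij := by
    simp [SimplicialObject.σ, ← Functor.map_comp, ← op_comp, σ_succ_cut _ _ hij]

/-- Any two `T`-valued vertices of `U` are the endpoints of a `T`-valued edge of the
`0`-coskeleton, `cosk₀(U)₁` being `U₀ × U₀`; so a lift of that edge to `U₁` joins them. The product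
is not made explicit: the edge is obtained from the universal property of the pointwise right Kan
extension. -/
theorem exists_to_cosk_zero [HasFiniteLimits C] {T : C} {U : SimplicialObject C}
    (ξ η : (SimplicialObject.const C).obj T ⟶ U) :
    ∃ w : T ⟶ ((SimplicialObject.cosk 0).obj U) _⦋1⦌, ∀ z : T ⟶ U _⦋1⦌,
      z ≫ ((SimplicialObject.coskAdj 0).unit.app U).app (op ⦋1⦌) = w →
        z ≫ U.δ 1 = ξ.app (op ⦋0⦌) ∧ z ≫ U.δ 0 = η.app (op ⦋0⦌) := by
  let ι := SimplexCategory.Truncated.inclusion 0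
  let F := (SimplicialObject.truncation 0).obj U
  let E : ι.op.RightExtension F := .mk _ (ι.op.ranCounit.app F)
  have hE : E.IsPointwiseRightKanExtension := ι.op.isPointwiseRightKanExtensionRanCounit F
  have hlim : IsLimit (E.coneAt (op ⦋1⦌)) := hE (op ⦋1⦌)
  -- The leg at `f : [m] → [1]`, where `m = 0`, is `ξ` or `η` according to the vertex hit by `f`.
  let ζ (f : StructuredArrow (op ⦋1⦌) ι.op) : (SimplicialObject.const C).obj T ⟶ U :=
    if f.hom.unop (0 : Fin (_ + 1)) = (0 : Fin 2) then ξ else η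
  have hζ {f g : StructuredArrow (op ⦋1⦌) ι.op} (φ : f ⟶ g) : ζ g = ζ f := by
    have : Subsingleton (Fin (f.right.unop.obj.len + 1)) := by
      have := f.right.unop.property
      exact Fin.subsingleton_iff_le_one.2 (Nat.succ_le_succ this)
    have hφ : g.hom.unop (0 : Fin (_ + 1)) = f.hom.unop (0 : Fin (_ + 1)) := by
      rw [← StructuredArrow.w φ]
      exact congrArg f.hom.unop (this.elim _ _)
    simp only [ζ, hφ]
  let c : Cone (StructuredArrow.proj (op ⦋1⦌) ι.op ⋙ F) :=
    { pt := T
      π :=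
        { app := fun f => (ζ f).app (ι.op.obj f.right)
          naturality := fun f g φ =>
            (congrArg (fun t => 𝟙 T ≫ NatTrans.app t (ι.op.obj g.right)) (hζ φ)).trans
              ((ζ f).naturality (ι.op.map φ.right)) } }
  refine ⟨hlim.lift c, fun z hz => ?_⟩
  have hleg (f : StructuredArrow (op ⦋1⦌) ι.op) : z ≫ U.map f.hom = c.π.app f := by
    rw [← hlim.fac c f, ← hz]
    have := (SimplicialObject.coskAdj 0).left_triangle_components U
    have hcounit : (SimplicialObject.coskAdj 0).counit.app F = ι.op.ranCounit.app F := by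
      simp [SimplicialObject.coskAdj, ι]
    rw [hcounit] at this
    have h₁ := NatTrans.congr_app this f.right
    have h₂ := ((SimplicialObject.coskAdj 0).unit.app U).naturality f.hom
    -- The unit followed by a leg of the limit cone is a structure map of `U`, by a triangle identity.
    have key : ((SimplicialObject.coskAdj 0).unit.app U).app (op ⦋1⦌) ≫
        (E.coneAt (op ⦋1⦌)).π.app f = U.map f.hom :=
      (Category.assoc _ _ _).symm.trans
        ((congrArg (· ≫ (ι.op.ranCounit.app F).app f.right) h₂.symm).trans
          ((Category.assoc _ _ _).trans
            ((congrArg (U.map f.hom ≫ ·) h₁).trans (Category.comp_id _))))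
    rw [← key]
    exact (Category.assoc _ _ _).symm
  let j (i : Fin 2) : StructuredArrow (op ⦋1⦌) ι.op :=
    .mk (T := ι.op) (Y := op (⟨⦋0⦌, le_rfl⟩ : SimplexCategory.Truncated 0))
      (Quiver.Hom.op (SimplexCategory.δ i : (⦋0⦌ : SimplexCategory) ⟶ ⦋1⦌))
  constructor
  · exact hleg (j 1)
  · exact hleg (j 0)

end Simplicial

/-! ### Lifting along pro-étale coverings -/

/-- Over a w-contractible scheme, a morphism factoring a quasi-compact weakly étale cover has a
section: the cover is refined by finitely many affine opens, whose disjoint union is an affine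
scheme weakly étale and surjective over the base. -/
theorem IsWContractible.exists_section_of_quasiCompactCover {W P : Scheme.{u}}
    (hW : IsWContractible W) (p : P ⟶ W) [WeaklyEtale p]
    (𝒰 : PreZeroHypercover.{u} W) [QuasiCompactCover 𝒰] (q : ∀ i, 𝒰.X i ⟶ P)
    (hq : ∀ i, q i ≫ p = 𝒰.f i) [∀ i, WeaklyEtale (𝒰.f i)] : ∃ s : W ⟶ P, s ≫ p = 𝟙 W := by
  have := hW.isAffine
  obtain ⟨n, f, V, hV, h⟩ := QuasiCompactCover.exists_isAffineOpen_of_isCompact 𝒰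
    (U := (⊤ : W.Opens)) isCompact_univ
  let A : Scheme.{u} := ∐ fun i => (V i).toScheme
  let a : A ⟶ P := Sigma.desc fun i => (V i).ι ≫ q _
  have haff (i) : IsAffine (V i).toScheme := hV i
  have hap : a ≫ p = Sigma.desc fun i => (V i).ι ≫ 𝒰.f _ := by
    ext i : 1
    simp [a, hq]
  have : WeaklyEtale (a ≫ p) := by
    rw [hap]
    exact IsZariskiLocalAtSource.sigmaDesc fun i => inferInstance
  have : Surjective (a ≫ p) := by
    constructor
    intro x
    have hx : x ∈ ((⊤ : W.Opens) : Set W) := trivial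
    rw [← h, Set.mem_iUnion] at hx
    obtain ⟨i, y, hy, rfl⟩ := hx
    refine ⟨Sigma.ι (fun i => (V i).toScheme) i (⟨y, hy⟩ : V i), ?_⟩
    have hi : Sigma.ι (fun i => (V i).toScheme) i ≫ a ≫ p = (V i).ι ≫ 𝒰.f _ := by
      rw [hap, Sigma.ι_desc]
    exact congrArg (fun (f : (V i).toScheme ⟶ W) => f (⟨y, hy⟩ : V i)) hi
  obtain ⟨s, hs⟩ := hW.exists_section A (a ≫ p) inferInstance inferInstance inferInstance
  exact ⟨s ≫ a, by simpa using hs⟩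

/-- A w-contractible scheme is projective with respect to pro-étale coverings. -/
theorem IsWContractible.exists_lift {W X Y : Scheme.{u}} (hW : IsWContractible W) {g : Y ⟶ X}
    (hg : Presieve.singleton g ∈ Scheme.proetalePrecoverage X) (w : W ⟶ X) :
    ∃ z : W ⟶ Y, z ≫ g = w := by
  have : QuasiCompactCover (PreZeroHypercover.singleton.{u} g) := by
    rw [← Scheme.presieve₀_mem_qcPrecoverage_iff, PreZeroHypercover.presieve₀_singleton]
    exact hg.1
  have : WeaklyEtale g := ((Scheme.singleton_mem_precoverage_iff _ _).1 hg.2).2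
  have (i : ((PreZeroHypercover.singleton.{u} g).pullback₁ w).I₀) :
      WeaklyEtale (((PreZeroHypercover.singleton.{u} g).pullback₁ w).f i) :=
    inferInstanceAs (WeaklyEtale (pullback.fst w g))
  obtain ⟨s, hs⟩ : ∃ s, s ≫ pullback.fst w g = 𝟙 W :=
    hW.exists_section_of_quasiCompactCover _ ((PreZeroHypercover.singleton.{u} g).pullback₁ w)
      (fun _ => 𝟙 _) (fun _ => Category.id_comp _)
  exact ⟨s ≫ pullback.snd w g, by
    rw [Category.assoc, ← pullback.condition, reassoc_of% hs]⟩

theorem IsWContractible.exists_lift_of_isCovering {W : Scheme.{u}} (hW : IsWContractible W)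
    {X Y : W.ProEt} {g : Y ⟶ X} (hg : IsCovering g) (w : self W ⟶ X) :
    ∃ z : self W ⟶ Y, z ≫ g = w := by
  unfold IsCovering Scheme.ProEt.precoverage at hg
  rw [Precoverage.mem_comap_iff, Presieve.map_singleton] at hg
  let G := Scheme.ProEt.forget W
  obtain ⟨z, hz⟩ : ∃ z : W ⟶ (G.obj Y).left, z ≫ (G.map g).left = (G.map w).left :=
    hW.exists_lift hg _
  have hz' : z ≫ (G.obj Y).hom = 𝟙 W :=
    (congrArg (z ≫ ·) (Over.w (G.map g)).symm).trans
      ((Category.assoc _ _ _).symm.trans ((congrArg (· ≫ (G.obj X).hom) hz).trans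
        (Over.w (G.map w))))
  refine ⟨(Scheme.ProEt.forgetFullyFaithful W).preimage (Over.homMk z hz' : _ ⟶ G.obj Y), ?_⟩
  apply (Scheme.ProEt.forget W).map_injective
  apply Over.OverMorphism.ext
  rw [Functor.map_comp, Functor.FullyFaithful.map_preimage]
  exact hz

/-! ### Hypercoverings of w-contractible schemes -/

/-- Only the covering `U₁ ⟶ cosk₀(U)₁` is used: an edge of `cosk₀(U)` joining the vertices of `ξ`
and `η` lifts to `U₁`. -/
theorem IsHypercovering.nonempty_homotopy {W : Scheme.{u}} (hW : IsWContractible W)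
    {U : SimplicialObject W.ProEt} (hU : IsHypercovering W U) (ξ η : constSelf W ⟶ U) :
    Nonempty (SimplicialObject.Homotopy ξ η) := by
  obtain ⟨w, hw⟩ := exists_to_cosk_zero ξ η
  obtain ⟨z, hz⟩ := hW.exists_lift_of_isCovering (hU.succ 0) w
  exact ⟨homotopyOfEdge ξ η z (hw z hz).1 (hw z hz).2⟩

theorem nonempty_isInitial_constHy {W : Scheme.{u}} (hW : IsWContractible W) :
    Nonempty (IsInitial (constHy W)) := by
  have (X : HoHy W) : Nonempty (constHy W ⟶ X) := by
    obtain ⟨⟨U, hU⟩⟩ := X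
    obtain ⟨x, -⟩ := hW.exists_lift_of_isCovering hU.zero (𝟙 _)
    exact ⟨(CategoryTheory.Quotient.functor _).map (ObjectProperty.homMk (constHomOfVertex x))⟩
  have (X : HoHy W) : Subsingleton (constHy W ⟶ X) := by
    obtain ⟨⟨U, hU⟩⟩ := X
    refine ⟨fun f g => ?_⟩
    obtain ⟨f, rfl⟩ := (CategoryTheory.Quotient.functor _).map_surjective f
    obtain ⟨g, rfl⟩ := (CategoryTheory.Quotient.functor _).map_surjective g
    exact CategoryTheory.Quotient.sound _ (hU.nonempty_homotopy hW f.hom g.hom)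
  exact ⟨IsInitial.ofUniqueHom (fun X => Classical.arbitrary _) fun _ _ => Subsingleton.elim _ _⟩

/-! ### Spectra of algebraically closed fields -/

/-- The diagonal of `Spec B` over `Spec k` is given by the multiplication map of `B`. -/
theorem isWContractible_of_isAlgClosed (k : Type u) [Field k] [IsAlgClosed k] :
    IsWContractible (Spec (.of k)) := by
  refine ⟨inferInstance, fun A f _ _ _ => ?_⟩
  obtain ⟨B, ⟨e⟩⟩ : ∃ B : CommRingCat.{u}, Nonempty (A ≅ Spec B) := ⟨_, ⟨A.isoSpec⟩⟩
  obtain ⟨φ, hφ⟩ := Spec.map_surjective (e.inv ≫ f)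
  algebraize [φ.hom]
  have : WeaklyEtale (Spec.map φ) := by rw [hφ]; infer_instance
  have : Surjective (Spec.map φ) := by rw [hφ]; infer_instance
  have hfl : (Algebra.TensorProduct.lmul' k (S := B)).Flat := by
    have h := WeaklyEtale.flat_diagonal (f := Spec.map φ)
    change Flat (pullback.diagonal (Spec.map (CommRingCat.ofHom (algebraMap k B)))) at h
    have : MorphismProperty.RespectsIso @Flat :=
      MorphismProperty.IsStableUnderBaseChange.respectsIso
    rw [diagonal_SpecMap, MorphismProperty.cancel_right_of_respectsIso @Flat, Flat.SpecMap_iff] at h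
    exact h
  have : Nontrivial B := by
    obtain ⟨x, -⟩ := (Spec.map φ).surjective (default : Spec (.of k))
    exact x.nontrivial
  obtain ⟨ψ⟩ := nonempty_algHom_of_flat_lmul' hfl
  refine ⟨Spec.map (CommRingCat.ofHom ψ.toRingHom) ≫ e.inv, ?_⟩
  rw [Category.assoc, ← hφ, ← Spec.map_comp, ← Spec.map_id]
  congr 1
  ext x
  exact ψ.commutes x

/-! ### Categories with an initial object -/

theorem initial_fromPUnit_of_isInitial {C : Type u} [Category.{v} C] {X : C} (hX : IsInitial X) :
    (Functor.fromPUnit.{0} X).Initial where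
  out Y := by
    have : Nonempty (CostructuredArrow (Functor.fromPUnit.{0} X) Y) :=
      ⟨CostructuredArrow.mk (S := Functor.fromPUnit.{0} X) (Y := ⟨⟨⟩⟩) (hX.to Y)⟩
    exact zigzag_isConnected fun a b =>
      .of_hom (CostructuredArrow.homMk (eqToHom (Subsingleton.elim _ _)) (hX.hom_ext _ _))

theorem isCofiltered_of_isInitial {C : Type u} [Category.{v} C] {X : C} (hX : IsInitial X) :
    IsCofiltered C where
  nonempty := ⟨X⟩
  cone_objs Y Z := ⟨X, hX.to Y, hX.to Z, trivial⟩
  cone_maps _ _ _ _ := ⟨X, hX.to _, hX.hom_ext _ _⟩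

/-- The projection of a pro-object to its member at an initial index is an isomorphism. -/
theorem ProObj.isIso_toConst {C : Type u} [Category.{v} C] (X : ProObj.{w, w'} C) {i : X.Index}
    (hi : IsInitial i) {Z : C} (f : X.diagram.obj i ⟶ Z) [IsIso f] : IsIso (X.toConst i f) := by
  let g : const.{w, w'} Z ⟶ X :=
    { val := fun j => Germ.mk (const.{w, w'} Z) ⟨⟩ (inv f ≫ X.diagram.map (hi.to j))
      compat := fun {j j'} ψ => by
        rw [Germ.postcomp_mk, Category.assoc, ← Functor.map_comp,
          hi.hom_ext (hi.to j ≫ ψ) (hi.to j')] : Hom (const Z) X }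
  refine ⟨g, ?_, ?_⟩
  · refine Hom.ext (funext fun j => ?_)
    change Germ.mk X i (f ≫ inv f ≫ X.diagram.map (hi.to j)) = Germ.mk X j (𝟙 _)
    rw [IsIso.hom_inv_id_assoc, ← Germ.mk_map X (hi.to j) (𝟙 _), Category.comp_id]
  · refine Hom.ext (funext fun j => ?_)
    change Germ.mk (const.{w, w'} Z) ⟨⟩ ((inv f ≫ X.diagram.map (hi.to i)) ≫ f) =
      Germ.mk (const.{w, w'} Z) j (𝟙 _)
    rw [hi.hom_ext (hi.to i) (𝟙 i), X.diagram.map_id, Category.comp_id, IsIso.inv_hom_id]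

end ProEtaleHomotopy

theorem mainTheorem3 :
    (∀ W : Scheme.{u}, ProEtaleHomotopy.IsWContractible W →
      (Functor.fromPUnit.{0} (ProEtaleHomotopy.constHy W)).Initial ∧
      ∃ _ : IsCofiltered (ProEtaleHomotopy.HoHy W),
        IsIso (ProEtaleHomotopy.toConstComponents W)) ∧
    ∀ (k : Type u) [Field k] [IsAlgClosed k],
      ProEtaleHomotopy.IsWContractible (Spec (.of k)) := by
  refine ⟨fun W hW => ?_, fun k _ _ => ProEtaleHomotopy.isWContractible_of_isAlgClosed k⟩
  obtain ⟨hc⟩ := ProEtaleHomotopy.nonempty_isInitial_constHy hW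
  exact ⟨ProEtaleHomotopy.initial_fromPUnit_of_isInitial hc,
    ProEtaleHomotopy.isCofiltered_of_isInitial hc,
    let _ := ProEtaleHomotopy.isCofiltered_of_isInitial hc
    ProEtaleHomotopy.ProObj.isIso_toConst (ProEtaleHomotopy.proEtaleHomotopyType W) hc _⟩
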